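/- Let $X$ be a finite nonempty set of propositional variables. A Kripke model $M=(W,R,\pi)$ over $X$ consists of a nonempty set $W$ of worlds, a relation $R\subseteq W\times W$ and a map $\pi\colon X\to 2^W$; a team of $M$ is a set $T\subseteq W$. Formulas of modal team logic $\mathsf{MTL}$ are given by $$\varphi ::= p\mid \neg p\mid {\sim}\varphi\mid(\varphi\wedge\varphi)\mid(\varphi\vee\varphi)\mid\Diamond\varphi\mid\Box\varphi\qquad(p\in X),$$ with the following semantics: $M,T\models p$ iff $T\subseteq\pi(p)$; $M,T\models\neg p$ iff $T\cap\pi(p)=\emptyset$; $M,T\models{\sim}\varphi$ iff $M,T\not\models\varphi$; $M,T\models\varphi\wedge\psi$ iff $M,T\models\varphi$ and $M,T\models\psi$; $M,T\models\varphi\vee\psi$ iff $T=T_1\cup T_2$ for some $T_1,T_2$ with $M,T_1\models\varphi$ and $M,T_2\models\psi$; $M,T\models\Diamond\varphi$ iff there is a team $T'$ with $M,T'\models\varphi$ such that every $w\in T$ has an $R$-successor in $T'$ and every $w'\in T'$ has an $R$-predecessor in $T$; $M,T\models\Box\varphi$ iff $M,T'\models\varphi$, where $T'$ is the set of all $R$-successors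 of worlds in $T$. Worlds $w_1$ of $M_1$ and $w_2$ of $M_2$ are $0$-bisimilar if they satisfy the same variables; they are $(k+1)$-bisimilar if they are $0$-bisimilar, each successor of $w_1$ is $k$-bisimilar to some successor of $w_2$, and each successor of $w_2$ is $k$-bisimilar to some successor of $w_1$. A bisimulation between $M_1$ and $M_2$ is a relation $Z\subseteq W_1\times W_2$ such that whenever $(w_1,w_2)\in Z$, the worlds $w_1,w_2$ satisfy the same variables, each successor of $w_1$ is $Z$-related to some successor of $w_2$, and each successor of $w_2$ is $Z$-related to some successor of $w_1$. The pairs $(M_1,T_1)$ and $(M_2,T_2)$ are $k$-bisimilar if every world of $T_1$ is $k$-bisimilar to some world of $T_2$ and vice versa; they are bisimilar if there is a bisimulation $Z$ such that every world of $T_1$ is $Z$-related to some world of $T_2$ and vice versa. A team property is a class $P$ of pairs $(M,T)$ with $M$ a Kripke model over $X$ and $T\neq\emptyset$ a team of $M$. An $\mathsf{MTL}$-formula $\varphi$ expresses $P$ if for all such pairs, $(M,T)\in P$ iff $M,T\models\varphi$. A first-order sentence over the signature with a binary symbol $E$ and unary symbols $T$ and $W_x$ ($x\in X$) expresses $P$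 if for all such pairs, $(M,T)\in P$ iff the sentence holds in the structure with universe $W$ in which $E$, $T$, $W_x$ are interpreted as $R$, $T$, $\pi(x)$. $P$ is ($k$-)bisimulation-invariant if $(M_1,T_1)\in P$ implies $(M_2,T_2)\in P$ whenever the two pairs are ($k$-)bisimilar. $P$ is local if for some $d\in\mathbb N$ and all such pairs, $(M,T)\in P$ iff $(N_M^d(T),T)\in P$, where $N_M^d(T)$ is the restriction of $M$ to the worlds reachable from some world of $T$ by a directed path of length at most $d$. **Theorem.** For every team property $P$ the following are equivalent: 1. some $\mathsf{MTL}$-formula expresses $P$; 2. some first-order sentence expresses $P$, and $P$ is bisimulation-invariant; 3. $P$ is $k$-bisimulation-invariant for some $k\in\mathbb N$; 4. $P$ is bisimulation-invariant and local. -/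

import Mathlib

universe u v

/-- A Kripke model over the set `X` of propositional variables: a nonempty set of worlds, an
accessibility relation, and for every variable the set of worlds in which it is true. -/
structure KripkeModel (X : Type v) where
  World : Type u
  nonempty : Nonempty World
  R : World → World → Prop
  val : X → Set World

/-- Formulas of modal team logic (negation normal form plus classical negation):
`p`, `¬ p`, `∼ φ`, `φ ∧ ψ`, `φ ∨ ψ`, `◇ φ`, `□ φ`. -/
inductive MTL (X : Type v) : Type v
  | var (p : X) : MTL X
  | negVar (p : X) : MTL X
  | tneg (φ : MTL X) : MTL X
  | and (φ ψ : MTL X) : MTL X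
  | or (φ ψ : MTL X) : MTL X
  | dia (φ : MTL X) : MTL X
  | box (φ : MTL X) : MTL X

/-- Team semantics: `φ.Sat M T` means `M, T ⊨ φ`. Here `or` is the splitting disjunction and
`tneg` is classical negation. -/
def MTL.Sat {X : Type v} (M : KripkeModel.{u} X) : MTL X → Set M.World → Prop
  | .var p, T => T ⊆ M.val p
  | .negVar p, T => T ∩ M.val p = ∅
  | .tneg φ, T => ¬ φ.Sat M T
  | .and φ ψ, T => φ.Sat M T ∧ ψ.Sat M T
  | .or φ ψ, T => ∃ T₁ T₂ : Set M.World, T = T₁ ∪ T₂ ∧ φ.Sat M T₁ ∧ ψ.Sat M T₂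
  | .dia φ, T => ∃ T' : Set M.World, φ.Sat M T' ∧
      (∀ w ∈ T, ∃ w' ∈ T', M.R w w') ∧ (∀ w' ∈ T', ∃ w ∈ T, M.R w w')
  | .box φ, T => φ.Sat M {w' | ∃ w ∈ T, M.R w w'}

/-- `SameVars M₁ M₂ w₁ w₂`: the two worlds satisfy the same propositional variables. -/
def SameVars {X : Type v} (M₁ M₂ : KripkeModel.{u} X) (w₁ : M₁.World) (w₂ : M₂.World) : Prop :=
  ∀ p : X, w₁ ∈ M₁.val p ↔ w₂ ∈ M₂.val p

/-- `k`-bisimilarity of pointed models. -/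
def KBisim {X : Type v} (M₁ M₂ : KripkeModel.{u} X) : ℕ → M₁.World → M₂.World → Prop
  | 0, w₁, w₂ => SameVars M₁ M₂ w₁ w₂
  | k + 1, w₁, w₂ => SameVars M₁ M₂ w₁ w₂ ∧
      (∀ w₁', M₁.R w₁ w₁' → ∃ w₂', M₂.R w₂ w₂' ∧ KBisim M₁ M₂ k w₁' w₂') ∧
      (∀ w₂', M₂.R w₂ w₂' → ∃ w₁', M₁.R w₁ w₁' ∧ KBisim M₁ M₂ k w₁' w₂')

/-- `Z` is a bisimulation between the worlds of `M₁` and those of `M₂`. -/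
def IsBisimulation {X : Type v} (M₁ M₂ : KripkeModel.{u} X)
    (Z : M₁.World → M₂.World → Prop) : Prop :=
  ∀ w₁ w₂, Z w₁ w₂ → SameVars M₁ M₂ w₁ w₂ ∧
    (∀ w₁', M₁.R w₁ w₁' → ∃ w₂', M₂.R w₂ w₂' ∧ Z w₁' w₂') ∧
    (∀ w₂', M₂.R w₂ w₂' → ∃ w₁', M₁.R w₁ w₁' ∧ Z w₁' w₂')

/-- A pair `(M, T)` of a Kripke model and a nonempty team of it. -/
structure TeamModel (X : Type v) where
  model : KripkeModel.{u} X
  team : Set model.World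
  team_nonempty : team.Nonempty

/-- The relation `Z` relates every world of `T₁` to some world of `T₂` and vice versa. -/
def TeamLift {α β : Type u} (Z : α → β → Prop) (T₁ : Set α) (T₂ : Set β) : Prop :=
  (∀ w₁ ∈ T₁, ∃ w₂ ∈ T₂, Z w₁ w₂) ∧ (∀ w₂ ∈ T₂, ∃ w₁ ∈ T₁, Z w₁ w₂)

/-- `k`-bisimilarity of models with teams. -/
def TeamKBisim {X : Type v} (k : ℕ) (A B : TeamModel.{u} X) : Prop :=
  TeamLift (KBisim A.model B.model k) A.team B.team

/-- (Full) bisimilarity of models with teams. -/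
def TeamBisim {X : Type v} (A B : TeamModel.{u} X) : Prop :=
  ∃ Z : A.model.World → B.model.World → Prop,
    IsBisimulation A.model B.model Z ∧ TeamLift Z A.team B.team

/-- A team property: a class of pairs `(M, T)` with `T` a nonempty team of `M`. -/
abbrev TeamProperty (X : Type v) := Set (TeamModel.{u} X)

/-- The `MTL`-formula `φ` expresses the team property `P`. -/
def MTL.Expresses {X : Type v} (φ : MTL X) (P : TeamProperty.{u} X) : Prop :=
  ∀ A : TeamModel.{u} X, A ∈ P ↔ φ.Sat A.model A.team

def KBisimInvariant {X : Type v} (k : ℕ) (P : TeamProperty.{u} X) : Prop :=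
  ∀ A B : TeamModel.{u} X, TeamKBisim k A B → A ∈ P → B ∈ P

def BisimInvariant {X : Type v} (P : TeamProperty.{u} X) : Prop :=
  ∀ A B : TeamModel.{u} X, TeamBisim A B → A ∈ P → B ∈ P

/-- There is a (directed) path of length `n` from one world to another. -/
def KripkeModel.HasPath {X : Type v} (M : KripkeModel.{u} X) : ℕ → M.World → M.World → Prop
  | 0, w, w' => w = w'
  | n + 1, w, w' => ∃ x, M.R w x ∧ M.HasPath n x w'

/-- The worlds whose distance from some world of `T` is at most `d`, where the distance from `w`
to `w'` is the length of a shortest path from `w` to `w'`. -/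
def KripkeModel.neighborhood {X : Type v} (M : KripkeModel.{u} X) (T : Set M.World) (d : ℕ) :
    Set M.World :=
  {w' | ∃ w ∈ T, ∃ n ≤ d, M.HasPath n w w'}

/-- The restriction of a model to a nonempty set of its worlds. -/
def KripkeModel.restrict {X : Type v} (M : KripkeModel.{u} X) (S : Set M.World)
    (hS : S.Nonempty) : KripkeModel.{u} X where
  World := S
  nonempty := hS.to_subtype
  R := fun w w' => M.R w w'
  val := fun p => {w | (w : M.World) ∈ M.val p}

theorem KripkeModel.subset_neighborhood {X : Type v} (M : KripkeModel.{u} X) (T : Set M.World)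
    (d : ℕ) : T ⊆ M.neighborhood T d :=
  fun w hw => ⟨w, hw, 0, Nat.zero_le d, rfl⟩

/-- The model restricted to the `d`-neighborhood of the team, with the same team. -/
def TeamModel.localize {X : Type v} (A : TeamModel.{u} X) (d : ℕ) : TeamModel.{u} X where
  model := A.model.restrict (A.model.neighborhood A.team d)
    (A.team_nonempty.mono (A.model.subset_neighborhood A.team d))
  team := {w | w.1 ∈ A.team}
  team_nonempty := by
    obtain ⟨w, hw⟩ := A.team_nonempty
    exact ⟨⟨w, A.model.subset_neighborhood A.team d hw⟩, hw⟩

def IsDLocal {X : Type v} (d : ℕ) (P : TeamProperty.{u} X) : Prop :=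
  ∀ A : TeamModel.{u} X, A ∈ P ↔ A.localize d ∈ P

def IsLocal {X : Type v} (P : TeamProperty.{u} X) : Prop :=
  ∃ d : ℕ, IsDLocal d P

/-- Relation symbols: a binary `E` for edges, a unary `T` for the team, and a unary `W_p` for
every propositional variable `p`. -/
inductive TeamRel (X : Type v) : ℕ → Type v
  | edge : TeamRel X 2
  | team : TeamRel X 1
  | holds (p : X) : TeamRel X 1

/-- The relational first-order signature of Kripke models with teams. -/
def teamLanguage (X : Type v) : FirstOrder.Language.{0, v} where
  Functions := fun _ => Empty
  Relations := TeamRel X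

/-- The first-order structure determined by a Kripke model with a team. -/
@[reducible]
def TeamModel.foStructure {X : Type v} (A : TeamModel.{u} X) :
    (teamLanguage X).Structure A.model.World where
  funMap := fun f _ => Empty.elim f
  RelMap := fun r x =>
    match r, x with
    | .edge, x => A.model.R (x 0) (x 1)
    | .team, x => x 0 ∈ A.team
    | .holds p, x => x 0 ∈ A.model.val p

/-- The first-order sentence `φ` expresses the team property `P`. -/
def FOExpresses {X : Type v} (φ : (teamLanguage X).Sentence) (P : TeamProperty.{u} X) : Prop :=
  ∀ A : TeamModel.{u} X,
    A ∈ P ↔ @FirstOrder.Language.Sentence.Realize (teamLanguage X) A.model.World A.foStructure φ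

open FirstOrder FirstOrder.Language

/-! ### Bisimilarity -/

section Bisimilarity

variable {X : Type v} {M₁ M₂ : KripkeModel.{u} X}

/-! Condition 3 is the hub. A formula of modal team logic inspects only finitely many steps, so 1
implies 3 by induction on formulas. Conversely, for finite `X` there are finitely many
`k`-bisimulation types, and a `k`-bisimulation-invariant property depends only on the set of types
realized in the team. It is thus a finite disjunction of conditions definable in both logics
(`KBisimInvariant.exists_mtl`, `KBisimInvariant.exists_sentence`). It is also local, since cutting a
model at distance `k` preserves `k`-types.

To return to 3 from 2 or 4, unravel a model into layers indexed by ℕ, which preserves it up to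
bisimilarity. Cutting after layer `d` leaves a model whose full bisimulation class depends only on
`d`-types (`TeamKBisim.layered`). So it suffices that `P` cannot tell the full copy from the cut
one. Both copies are put into a single model, and only the team moves between them
(`BisimInvariant.kBisimInvariant`). If `P` is `d`-local, the `d`-neighborhood of the full copy is
already bisimilar to the cut copy. If `P` is first-order, an Ehrenfeucht–Fraïssé argument applies:
swapping the copies up to layer `c` moves the team and damages only edges leaving layer `c`, and `c`
can be kept far from every chosen element (`exists_realize_swap_iff`). -/

theorem SameVars.symm {w₁ : M₁.World} {w₂ : M₂.World} (h : SameVars M₁ M₂ w₁ w₂) :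
    SameVars M₂ M₁ w₂ w₁ :=
  fun p => (h p).symm

theorem KBisim.sameVars {k : ℕ} {w₁ : M₁.World} {w₂ : M₂.World} (h : KBisim M₁ M₂ k w₁ w₂) :
    SameVars M₁ M₂ w₁ w₂ := by
  cases k with
  | zero => exact h
  | succ k => exact h.1

theorem KBisim.symm {k : ℕ} {w₁ : M₁.World} {w₂ : M₂.World} (h : KBisim M₁ M₂ k w₁ w₂) :
    KBisim M₂ M₁ k w₂ w₁ := by
  induction k generalizing w₁ w₂ with
  | zero => exact SameVars.symm h
  | succ k ih =>
    refine ⟨h.1.symm, fun v hv => ?_, fun v hv => ?_⟩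
    · obtain ⟨v', hv', hb⟩ := h.2.2 v hv
      exact ⟨v', hv', ih hb⟩
    · obtain ⟨v', hv', hb⟩ := h.2.1 v hv
      exact ⟨v', hv', ih hb⟩

theorem KBisim.of_succ {k : ℕ} {w₁ : M₁.World} {w₂ : M₂.World}
    (h : KBisim M₁ M₂ (k + 1) w₁ w₂) : KBisim M₁ M₂ k w₁ w₂ := by
  induction k generalizing w₁ w₂ with
  | zero => exact h.1
  | succ k ih =>
    refine ⟨h.1, fun v hv => ?_, fun v hv => ?_⟩
    · obtain ⟨v', hv', hb⟩ := h.2.1 v hv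
      exact ⟨v', hv', ih hb⟩
    · obtain ⟨v', hv', hb⟩ := h.2.2 v hv
      exact ⟨v', hv', ih hb⟩

theorem KBisim.mono {j k : ℕ} (hjk : j ≤ k) {w₁ : M₁.World} {w₂ : M₂.World}
    (h : KBisim M₁ M₂ k w₁ w₂) : KBisim M₁ M₂ j w₁ w₂ := by
  induction hjk with
  | refl => exact h
  | step _ ih => exact ih h.of_succ

theorem IsBisimulation.kBisim {Z : M₁.World → M₂.World → Prop} (hZ : IsBisimulation M₁ M₂ Z)
    (k : ℕ) {w₁ : M₁.World} {w₂ : M₂.World} (h : Z w₁ w₂) : KBisim M₁ M₂ k w₁ w₂ := by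
  induction k generalizing w₁ w₂ with
  | zero => exact (hZ _ _ h).1
  | succ k ih =>
    obtain ⟨h0, h1, h2⟩ := hZ _ _ h
    refine ⟨h0, fun v hv => ?_, fun v hv => ?_⟩
    · obtain ⟨v', hv', hb⟩ := h1 v hv
      exact ⟨v', hv', ih hb⟩
    · obtain ⟨v', hv', hb⟩ := h2 v hv
      exact ⟨v', hv', ih hb⟩

theorem TeamLift.imp {α β : Type u} {Z Z' : α → β → Prop} (h : ∀ a b, Z a b → Z' a b)
    {S : Set α} {T : Set β} (hl : TeamLift Z S T) : TeamLift Z' S T := by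
  refine ⟨fun a ha => ?_, fun b hb => ?_⟩
  · obtain ⟨b, hb, hz⟩ := hl.1 a ha
    exact ⟨b, hb, h _ _ hz⟩
  · obtain ⟨a, ha, hz⟩ := hl.2 b hb
    exact ⟨a, ha, h _ _ hz⟩

theorem TeamLift.symm_kBisim {k : ℕ} {T₁ : Set M₁.World} {T₂ : Set M₂.World}
    (h : TeamLift (KBisim M₁ M₂ k) T₁ T₂) : TeamLift (KBisim M₂ M₁ k) T₂ T₁ := by
  refine ⟨fun a ha => ?_, fun b hb => ?_⟩
  · obtain ⟨b, hb, hz⟩ := h.2 a ha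
    exact ⟨b, hb, hz.symm⟩
  · obtain ⟨a, ha, hz⟩ := h.1 b hb
    exact ⟨a, ha, hz.symm⟩

theorem TeamBisim.symm {A B : TeamModel.{u} X} (h : TeamBisim A B) : TeamBisim B A := by
  obtain ⟨Z, hZ, hl⟩ := h
  refine ⟨fun b a => Z a b, fun b a hab => ?_, hl.2, hl.1⟩
  obtain ⟨h0, h1, h2⟩ := hZ a b hab
  exact ⟨h0.symm, h2, h1⟩

theorem BisimInvariant.mem_iff {P : TeamProperty.{u} X} (hP : BisimInvariant P)
    {A B : TeamModel.{u} X} (h : TeamBisim A B) : A ∈ P ↔ B ∈ P :=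
  ⟨hP A B h, hP B A h.symm⟩

theorem KBisimInvariant.bisimInvariant {P : TeamProperty.{u} X} {k : ℕ}
    (hP : KBisimInvariant k P) : BisimInvariant P := by
  rintro A B ⟨Z, hZ, hl⟩
  exact hP A B (hl.imp fun _ _ h => hZ.kBisim k h)

theorem TeamKBisim.symm {k : ℕ} {A B : TeamModel.{u} X} (h : TeamKBisim k A B) :
    TeamKBisim k B A :=
  h.symm_kBisim

/-- Every formula of modal team logic is invariant under `k`-bisimilarity for some `k`. -/
theorem MTL.exists_kBisim_invariant (φ : MTL X) :
    ∃ k : ℕ, ∀ (M₁ M₂ : KripkeModel.{u} X) (T₁ : Set M₁.World) (T₂ : Set M₂.World),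
      TeamLift (KBisim M₁ M₂ k) T₁ T₂ → φ.Sat M₁ T₁ → φ.Sat M₂ T₂ := by
  induction φ with
  | var p =>
    refine ⟨0, fun M₁ M₂ T₁ T₂ h hs w hw => ?_⟩
    obtain ⟨w', hw', hb⟩ := h.2 w hw
    exact (hb p).1 (hs hw')
  | negVar p =>
    refine ⟨0, fun M₁ M₂ T₁ T₂ h hs => Set.eq_empty_iff_forall_notMem.2 ?_⟩
    rintro w ⟨hw, hp⟩
    obtain ⟨w', hw', hb⟩ := h.2 w hw
    exact Set.eq_empty_iff_forall_notMem.1 hs w' ⟨hw', (hb p).2 hp⟩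
  | tneg φ ih =>
    obtain ⟨k, hk⟩ := ih
    exact ⟨k, fun M₁ M₂ T₁ T₂ h hs hs' => hs (hk _ _ _ _ h.symm_kBisim hs')⟩
  | and φ ψ ih₁ ih₂ =>
    obtain ⟨k, hk⟩ := ih₁
    obtain ⟨l, hl⟩ := ih₂
    exact ⟨max k l, fun M₁ M₂ T₁ T₂ h hs =>
      ⟨hk _ _ _ _ (h.imp fun _ _ hb => hb.mono (le_max_left k l)) hs.1,
        hl _ _ _ _ (h.imp fun _ _ hb => hb.mono (le_max_right k l)) hs.2⟩⟩
  | or φ ψ ih₁ ih₂ =>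
    obtain ⟨k, hk⟩ := ih₁
    obtain ⟨l, hl⟩ := ih₂
    refine ⟨max k l, fun M₁ M₂ T₁ T₂ h hs => ?_⟩
    obtain ⟨S, S', rfl, hS, hS'⟩ := hs
    -- Each half of a split is transferred to all of its partners in `T₂`. The two images may
    -- overlap, which the splitting disjunction allows.
    have key : ∀ U : Set M₁.World, U ⊆ S ∪ S' → TeamLift (KBisim M₁ M₂ (max k l)) U
        {w | w ∈ T₂ ∧ ∃ v ∈ U, KBisim M₁ M₂ (max k l) v w} := by
      refine fun U hU => ⟨fun v hv => ?_, fun w hw => hw.2⟩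
      obtain ⟨w, hw, hb⟩ := h.1 v (hU hv)
      exact ⟨w, ⟨hw, v, hv, hb⟩, hb⟩
    refine ⟨_, _, ?_,
      hk _ _ _ _ ((key S Set.subset_union_left).imp fun _ _ hb => hb.mono (le_max_left k l)) hS,
      hl _ _ _ _ ((key S' Set.subset_union_right).imp fun _ _ hb => hb.mono (le_max_right k l)) hS'⟩
    ext w
    constructor
    · intro hw
      obtain ⟨v, hv | hv, hb⟩ := h.2 w hw
      · exact Or.inl ⟨hw, v, hv, hb⟩
      · exact Or.inr ⟨hw, v, hv, hb⟩
    · rintro (hw | hw)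
      · exact hw.1
      · exact hw.1
  | dia φ ih =>
    obtain ⟨k, hk⟩ := ih
    refine ⟨k + 1, fun M₁ M₂ T₁ T₂ h hs => ?_⟩
    obtain ⟨S, hS, hTS, hST⟩ := hs
    -- The witness team takes every successor of `T₂` that matches a world of `S`. One level of
    -- bisimilarity is spent on the step.
    refine ⟨{w | (∃ v ∈ S, KBisim M₁ M₂ k v w) ∧ ∃ x ∈ T₂, M₂.R x w},
      hk _ _ _ _ ⟨fun v hv => ?_, fun w hw => hw.1⟩ hS, fun w hw => ?_, fun w hw => hw.2⟩
    · obtain ⟨x, hx, hxv⟩ := hST v hv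
      obtain ⟨y, hy, hb⟩ := h.1 x hx
      obtain ⟨z, hz, hb'⟩ := hb.2.1 v hxv
      exact ⟨z, ⟨⟨v, hv, hb'⟩, y, hy, hz⟩, hb'⟩
    · obtain ⟨x, hx, hb⟩ := h.2 w hw
      obtain ⟨y, hy, hxy⟩ := hTS x hx
      obtain ⟨z, hz, hb'⟩ := hb.2.1 y hxy
      exact ⟨z, ⟨⟨y, hy, hb'⟩, w, hw, hz⟩, hz⟩
  | box φ ih =>
    obtain ⟨k, hk⟩ := ih
    refine ⟨k + 1, fun M₁ M₂ T₁ T₂ h hs => hk _ _ _ _ ⟨?_, ?_⟩ hs⟩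
    · rintro v ⟨x, hx, hxv⟩
      obtain ⟨y, hy, hb⟩ := h.1 x hx
      obtain ⟨z, hz, hb'⟩ := hb.2.1 v hxv
      exact ⟨z, ⟨y, hy, hz⟩, hb'⟩
    · rintro v ⟨x, hx, hxv⟩
      obtain ⟨y, hy, hb⟩ := h.2 x hx
      obtain ⟨z, hz, hb'⟩ := hb.2.2 v hxv
      exact ⟨z, ⟨y, hy, hz⟩, hb'⟩

end Bisimilarity

/-! ### Types of worlds -/

section Types

/-- The possible `k`-bisimulation types of worlds. -/
def BisimType (X : Type v) : ℕ → Type v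
  | 0 => Set X
  | k + 1 => Set X × Set (BisimType X k)

instance BisimType.finite (X : Type v) [Finite X] (k : ℕ) : Finite (BisimType X k) := by
  induction k with
  | zero => exact inferInstanceAs (Finite (Set X))
  | succ k ih => exact inferInstanceAs (Finite (Set X × Set (BisimType X k)))

variable {X : Type v}

/-- The `k`-bisimulation type of a world. -/
def KripkeModel.bisimType (M : KripkeModel.{u} X) : (k : ℕ) → M.World → BisimType X k
  | 0, w => {p | w ∈ M.val p}
  | k + 1, w => ({p | w ∈ M.val p}, {σ | ∃ w', M.R w w' ∧ M.bisimType k w' = σ})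

theorem KripkeModel.bisimType_zero_eq_iff (M : KripkeModel.{u} X) (w : M.World)
    (σ : BisimType X 0) :
    M.bisimType 0 w = σ ↔ ∀ p, w ∈ M.val p ↔ p ∈ (show Set X from σ) :=
  Set.ext_iff

/-- The three clauses have the shape of literals, one box and a finite family of diamonds, ready for
translation into either logic. -/
theorem KripkeModel.bisimType_succ_eq_iff (M : KripkeModel.{u} X) (k : ℕ) (w : M.World)
    (σ : BisimType X (k + 1)) :
    M.bisimType (k + 1) w = σ ↔ (∀ p, w ∈ M.val p ↔ p ∈ σ.1) ∧
      (∀ w', M.R w w' → M.bisimType k w' ∈ σ.2) ∧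
      ∀ τ : σ.2, ∃ w', M.R w w' ∧ M.bisimType k w' = τ := by
  obtain ⟨V, S⟩ := σ
  refine Prod.ext_iff.trans (and_congr Set.ext_iff ?_)
  refine Set.Subset.antisymm_iff.trans (and_congr ?_ ?_)
  · constructor
    · exact fun h w' hw' => h ⟨w', hw', rfl⟩
    · rintro h _ ⟨w', hw', rfl⟩
      exact h w' hw'
  · exact ⟨fun h τ => h τ.2, fun h τ hτ => h ⟨τ, hτ⟩⟩

theorem KBisim.iff_bisimType_eq {M₁ M₂ : KripkeModel.{u} X} {k : ℕ} {w₁ : M₁.World}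
    {w₂ : M₂.World} : KBisim M₁ M₂ k w₁ w₂ ↔ M₁.bisimType k w₁ = M₂.bisimType k w₂ := by
  induction k generalizing w₁ w₂ with
  | zero => exact Set.ext_iff.symm
  | succ k ih =>
    refine Iff.trans ?_ Prod.ext_iff.symm
    refine and_congr Set.ext_iff.symm ?_
    refine Iff.trans (and_congr ?_ ?_) Set.Subset.antisymm_iff.symm
    · constructor
      · rintro h _ ⟨v, hv, rfl⟩
        obtain ⟨v', hv', hb⟩ := h v hv
        exact ⟨v', hv', (ih.1 hb).symm⟩
      · intro h v hv
        obtain ⟨v', hv', hb⟩ := h ⟨v, hv, rfl⟩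
        exact ⟨v', hv', ih.2 hb.symm⟩
    · constructor
      · rintro h _ ⟨v, hv, rfl⟩
        obtain ⟨v', hv', hb⟩ := h v hv
        exact ⟨v', hv', ih.1 hb⟩
      · intro h v hv
        obtain ⟨v', hv', hb⟩ := h ⟨v, hv, rfl⟩
        exact ⟨v', hv', ih.2 hb⟩

/-- The set of `k`-bisimulation types realized in a team. -/
def TeamModel.bisimTypes (k : ℕ) (A : TeamModel.{u} X) : Set (BisimType X k) :=
  A.model.bisimType k '' A.team

theorem TeamModel.bisimTypes_eq_iff {k : ℕ} (A : TeamModel.{u} X) (S : Set (BisimType X k)) :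
    A.bisimTypes k = S ↔ (∀ w ∈ A.team, A.model.bisimType k w ∈ S) ∧
      ∀ τ : S, ∃ w ∈ A.team, A.model.bisimType k w = τ := by
  refine Set.Subset.antisymm_iff.trans (and_congr Set.image_subset_iff ?_)
  exact ⟨fun h τ => h τ.2, fun h τ hτ => h ⟨τ, hτ⟩⟩

theorem TeamKBisim.of_bisimTypes_eq {k : ℕ} {A B : TeamModel.{u} X}
    (h : A.bisimTypes k = B.bisimTypes k) : TeamKBisim k A B := by
  refine ⟨fun w hw => ?_, fun w hw => ?_⟩
  · obtain ⟨v, hv, hb⟩ := h.subset (Set.mem_image_of_mem _ hw)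
    exact ⟨v, hv, KBisim.iff_bisimType_eq.2 hb.symm⟩
  · obtain ⟨v, hv, hb⟩ := h.superset (Set.mem_image_of_mem _ hw)
    exact ⟨v, hv, KBisim.iff_bisimType_eq.2 hb⟩

/-- For finite `X` the index set is finite, so the right-hand side is a finite disjunction even
though `P` may be a proper class of models. -/
theorem KBisimInvariant.mem_iff {k : ℕ} {P : TeamProperty.{u} X} (hP : KBisimInvariant k P)
    (A : TeamModel.{u} X) :
    A ∈ P ↔ ∃ S : TeamModel.bisimTypes k '' P, A.bisimTypes k = S := by
  constructor
  · exact fun h => ⟨⟨_, A, h, rfl⟩, rfl⟩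
  · rintro ⟨⟨_, B, hB, rfl⟩, h⟩
    exact hP B A (.of_bisimTypes_eq h.symm) hB

end Types

/-! ### Definability of types in modal team logic -/

section ModalDefinability

variable {X : Type v}

theorem MTL.exists_top [Nonempty X] :
    ∃ φ : MTL X, ∀ (M : KripkeModel.{u} X) (T : Set M.World), φ.Sat M T := by
  obtain ⟨p⟩ := ‹Nonempty X›
  exact ⟨.tneg (.and (.var p) (.tneg (.var p))), fun M T h => h.2 h.1⟩

theorem MTL.exists_forall [Nonempty X] {ι : Type*} [Finite ι] (f : ι → MTL X) :
    ∃ φ : MTL X, ∀ (M : KripkeModel.{u} X) (T : Set M.World),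
      φ.Sat M T ↔ ∀ i, (f i).Sat M T := by
  classical
  have := Fintype.ofFinite ι
  suffices h : ∀ s : Finset ι, ∃ φ : MTL X, ∀ (M : KripkeModel.{u} X) (T : Set M.World),
      φ.Sat M T ↔ ∀ i ∈ s, (f i).Sat M T by
    simpa using h Finset.univ
  intro s
  induction s using Finset.induction_on with
  | empty =>
    obtain ⟨φ, hφ⟩ := MTL.exists_top.{u} (X := X)
    exact ⟨φ, fun M T => iff_of_true (hφ M T) (by simp)⟩
  | insert a s _ ih =>
    obtain ⟨φ, hφ⟩ := ih
    refine ⟨.and (f a) φ, fun M T => ?_⟩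
    simp [MTL.Sat, hφ]

theorem MTL.exists_exists [Nonempty X] {ι : Type*} [Finite ι] (f : ι → MTL X) :
    ∃ φ : MTL X, ∀ (M : KripkeModel.{u} X) (T : Set M.World),
      φ.Sat M T ↔ ∃ i, (f i).Sat M T := by
  obtain ⟨φ, hφ⟩ := MTL.exists_forall.{u} fun i => (f i).tneg
  refine ⟨φ.tneg, fun M T => ?_⟩
  simp [MTL.Sat, hφ]

/-- A property of worlds is flatly definable if some formula of modal team logic holds exactly in
the teams all of whose worlds have the property. -/
def FlatDefinable (Q : (M : KripkeModel.{u} X) → M.World → Prop) : Prop :=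
  ∃ φ : MTL X, ∀ (M : KripkeModel.{u} X) (T : Set M.World), φ.Sat M T ↔ ∀ w ∈ T, Q M w

variable {Q Q' : (M : KripkeModel.{u} X) → M.World → Prop}

theorem FlatDefinable.and (h : FlatDefinable Q) (h' : FlatDefinable Q') :
    FlatDefinable fun M w => Q M w ∧ Q' M w := by
  obtain ⟨φ, hφ⟩ := h
  obtain ⟨ψ, hψ⟩ := h'
  exact ⟨.and φ ψ, fun M T => (and_congr (hφ M T) (hψ M T)).trans forall₂_and.symm⟩

theorem FlatDefinable.or (h : FlatDefinable Q) (h' : FlatDefinable Q') :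
    FlatDefinable fun M w => Q M w ∨ Q' M w := by
  obtain ⟨φ, hφ⟩ := h
  obtain ⟨ψ, hψ⟩ := h'
  refine ⟨.or φ ψ, fun M T => ⟨?_, fun h => ?_⟩⟩
  · rintro ⟨S, S', rfl, hS, hS'⟩ w (hw | hw)
    · exact .inl ((hφ M S).1 hS w hw)
    · exact .inr ((hψ M S').1 hS' w hw)
  · refine ⟨{w ∈ T | Q M w}, {w ∈ T | Q' M w}, ?_, (hφ _ _).2 fun w hw => hw.2,
      (hψ _ _).2 fun w hw => hw.2⟩
    ext w
    have := h w
    simp only [Set.mem_union, Set.mem_ofPred_eq]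
    tauto

theorem FlatDefinable.forall [Nonempty X] {ι : Type*} [Finite ι]
    {Q : ι → (M : KripkeModel.{u} X) → M.World → Prop} (h : ∀ i, FlatDefinable (Q i)) :
    FlatDefinable fun M w => ∀ i, Q i M w := by
  choose f hf using h
  obtain ⟨φ, hφ⟩ := MTL.exists_forall.{u} f
  refine ⟨φ, fun M T => ?_⟩
  simp only [hφ, hf]
  exact ⟨fun h w hw i => h i w hw, fun h i w hw => h w hw i⟩

theorem FlatDefinable.false [Nonempty X] :
    FlatDefinable fun (M : KripkeModel.{u} X) (_ : M.World) => False := by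
  obtain ⟨p⟩ := ‹Nonempty X›
  refine ⟨.and (.var p) (.negVar p), fun M T => ?_⟩
  simp only [MTL.Sat, Set.eq_empty_iff_forall_notMem]
  exact ⟨fun h w hw => h.2 w ⟨hw, h.1 hw⟩, fun h => ⟨fun w hw => (h w hw).elim,
    fun w hw => h w hw.1⟩⟩

/-- Splitting disjunction is needed here: the classical one of `MTL.exists_exists` would demand a
single `i` for the whole team. -/
theorem FlatDefinable.exists [Nonempty X] {ι : Type*} [Finite ι]
    {Q : ι → (M : KripkeModel.{u} X) → M.World → Prop} (h : ∀ i, FlatDefinable (Q i)) :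
    FlatDefinable fun M w => ∃ i, Q i M w := by
  classical
  have := Fintype.ofFinite ι
  suffices h : ∀ s : Finset ι, FlatDefinable fun M w => ∃ i ∈ s, Q i M w by
    simpa using h Finset.univ
  intro s
  induction s using Finset.induction_on with
  | empty => simpa using FlatDefinable.false
  | insert a s _ ih => simpa using (h a).or ih

theorem FlatDefinable.val (p : X) (V : Set X) :
    FlatDefinable fun (M : KripkeModel.{u} X) w => w ∈ M.val p ↔ p ∈ V := by
  by_cases hp : p ∈ V
  · exact ⟨.var p, fun M T => by simp [MTL.Sat, hp, Set.subset_def]⟩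
  · exact ⟨.negVar p, fun M T => by simp [MTL.Sat, hp, Set.eq_empty_iff_forall_notMem]⟩

theorem FlatDefinable.dia (h : FlatDefinable Q) :
    FlatDefinable fun M w => ∃ w', M.R w w' ∧ Q M w' := by
  obtain ⟨φ, hφ⟩ := h
  refine ⟨.dia φ, fun M T => ⟨?_, fun h => ?_⟩⟩
  · rintro ⟨S, hS, hTS, -⟩ w hw
    obtain ⟨w', hw', hR⟩ := hTS w hw
    exact ⟨w', hR, (hφ M S).1 hS w' hw'⟩
  · refine ⟨{w' | Q M w' ∧ ∃ w ∈ T, M.R w w'}, (hφ _ _).2 fun w hw => hw.1, fun w hw => ?_,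
      fun w hw => hw.2⟩
    obtain ⟨w', hR, hQ⟩ := h w hw
    exact ⟨w', ⟨hQ, w, hw, hR⟩, hR⟩

theorem FlatDefinable.box (h : FlatDefinable Q) :
    FlatDefinable fun M w => ∀ w', M.R w w' → Q M w' := by
  obtain ⟨φ, hφ⟩ := h
  refine ⟨.box φ, fun M T => (hφ M _).trans ?_⟩
  exact ⟨fun h w hw w' hR => h w' ⟨w, hw, hR⟩, fun h w' ⟨w, hw, hR⟩ => h w hw w' hR⟩

theorem FlatDefinable.mem_of_eq [Finite X] [Nonempty X] {k : ℕ}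
    (h : ∀ σ, FlatDefinable fun (M : KripkeModel.{u} X) w => M.bisimType k w = σ)
    (S : Set (BisimType X k)) :
    FlatDefinable fun (M : KripkeModel.{u} X) w => M.bisimType k w ∈ S := by
  simpa using FlatDefinable.exists fun τ : S => h τ

/-- This is the usual characteristic (Hintikka) formula of a type; it works for teams because
literals, splitting disjunction, box and diamond all preserve flatness. -/
theorem FlatDefinable.bisimType_eq [Finite X] [Nonempty X] (k : ℕ) (σ : BisimType X k) :
    FlatDefinable fun (M : KripkeModel.{u} X) w => M.bisimType k w = σ := by
  induction k with
  | zero =>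
    simp only [KripkeModel.bisimType_zero_eq_iff]
    exact .forall fun p => .val p _
  | succ k ih =>
    simp only [KripkeModel.bisimType_succ_eq_iff]
    exact .and (.forall fun p => .val p _)
      (.and (.box (.mem_of_eq ih _)) (.forall fun τ : σ.2 => .dia (ih τ)))

theorem KBisimInvariant.exists_mtl [Finite X] [Nonempty X] {k : ℕ} {P : TeamProperty.{u} X}
    (hP : KBisimInvariant k P) : ∃ φ : MTL X, φ.Expresses P := by
  have hall : ∀ S : Set (BisimType X k), ∃ φ : MTL X, ∀ A : TeamModel.{u} X,
      φ.Sat A.model A.team ↔ ∀ w ∈ A.team, A.model.bisimType k w ∈ S := by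
    intro S
    obtain ⟨φ, hφ⟩ := FlatDefinable.mem_of_eq (FlatDefinable.bisimType_eq.{u} k) S
    exact ⟨φ, fun A => hφ A.model A.team⟩
  have heq : ∀ S : Set (BisimType X k), ∃ φ : MTL X, ∀ A : TeamModel.{u} X,
      φ.Sat A.model A.team ↔ A.bisimTypes k = S := by
    intro S
    choose f hf using hall
    -- That some world of the team has type `τ` is not flat; it is the classical negation of all
    -- worlds avoiding `τ`.
    obtain ⟨φ, hφ⟩ := MTL.exists_forall.{u} fun τ : S => (f {τ.1}ᶜ).tneg
    refine ⟨.and (f S) φ, fun A => ?_⟩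
    simp [TeamModel.bisimTypes_eq_iff, MTL.Sat, hφ, hf]
  choose f hf using heq
  obtain ⟨φ, hφ⟩ := MTL.exists_exists.{u} fun S : TeamModel.bisimTypes k '' P => f S
  exact ⟨φ, fun A => by rw [hP.mem_iff, hφ]; simp only [hf]⟩

end ModalDefinability

/-! ### Definability of types in first-order logic -/

section FirstOrderDefinability

variable {X : Type v}

/-- Satisfaction of a first-order formula in the structure of a model with a team. -/
abbrev TeamModel.Realize (A : TeamModel.{u} X) {n : ℕ}
    (φ : (teamLanguage X).BoundedFormula Empty n) (xs : Fin n → A.model.World) : Prop :=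
  @BoundedFormula.Realize (teamLanguage X) A.model.World A.foStructure Empty n φ default xs

variable {n : ℕ}

/-- The atomic formula saying that the `i`th variable has property `r`. -/
def unaryAtom (r : TeamRel X 1) (i : Fin n) : (teamLanguage X).BoundedFormula Empty n :=
  BoundedFormula.rel (L := teamLanguage X) r ![.var (.inr i)]

/-- The atomic formula saying that there is an edge between two variables. -/
def edgeAtom (i j : Fin n) : (teamLanguage X).BoundedFormula Empty n :=
  BoundedFormula.rel (L := teamLanguage X) TeamRel.edge ![.var (.inr i), .var (.inr j)]

theorem realize_team (A : TeamModel.{u} X) (i : Fin n) (xs : Fin n → A.model.World) :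
    A.Realize (unaryAtom .team i) xs ↔ xs i ∈ A.team :=
  Iff.rfl

theorem realize_holds (A : TeamModel.{u} X) (p : X) (i : Fin n) (xs : Fin n → A.model.World) :
    A.Realize (unaryAtom (.holds p) i) xs ↔ xs i ∈ A.model.val p :=
  Iff.rfl

theorem realize_edge (A : TeamModel.{u} X) (i j : Fin n) (xs : Fin n → A.model.World) :
    A.Realize (edgeAtom i j) xs ↔ A.model.R (xs i) (xs j) :=
  Iff.rfl

/-- A property of tuples is first-order definable, uniformly in all models with teams. -/
def TupleDefinable (n : ℕ) (Q : (A : TeamModel.{u} X) → (Fin n → A.model.World) → Prop) : Prop :=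
  ∃ φ : (teamLanguage X).BoundedFormula Empty n, ∀ (A : TeamModel.{u} X) xs,
    A.Realize φ xs ↔ Q A xs

variable {Q Q' : (A : TeamModel.{u} X) → (Fin n → A.model.World) → Prop}

theorem TupleDefinable.and (h : TupleDefinable n Q) (h' : TupleDefinable n Q') :
    TupleDefinable n fun A xs => Q A xs ∧ Q' A xs := by
  obtain ⟨φ, hφ⟩ := h
  obtain ⟨ψ, hψ⟩ := h'
  refine ⟨φ ⊓ ψ, fun A xs => ?_⟩
  let := A.foStructure
  exact BoundedFormula.realize_inf.trans (and_congr (hφ A xs) (hψ A xs))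

theorem TupleDefinable.imp (h : TupleDefinable n Q) (h' : TupleDefinable n Q') :
    TupleDefinable n fun A xs => Q A xs → Q' A xs := by
  obtain ⟨φ, hφ⟩ := h
  obtain ⟨ψ, hψ⟩ := h'
  exact ⟨φ.imp ψ, fun A xs => imp_congr (hφ A xs) (hψ A xs)⟩

theorem TupleDefinable.const (q : Prop) :
    TupleDefinable n fun (A : TeamModel.{u} X) (_ : Fin n → A.model.World) => q := by
  by_cases hq : q
  · exact ⟨.imp .falsum .falsum, fun A xs => iff_of_true (fun h => h) hq⟩
  · exact ⟨.falsum, fun A xs => iff_of_false (fun h => h) hq⟩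

theorem TupleDefinable.iff (h : TupleDefinable n Q) (h' : TupleDefinable n Q') :
    TupleDefinable n fun A xs => (Q A xs ↔ Q' A xs) := by
  simpa only [iff_def] using (h.imp h').and (h'.imp h)

theorem TupleDefinable.forall_fin {ι : Type*} [Finite ι]
    {Q : ι → (A : TeamModel.{u} X) → (Fin n → A.model.World) → Prop}
    (h : ∀ i, TupleDefinable n (Q i)) : TupleDefinable n fun A xs => ∀ i, Q i A xs := by
  choose f hf using h
  refine ⟨BoundedFormula.iInf f, fun A xs => ?_⟩
  let := A.foStructure
  exact BoundedFormula.realize_iInf.trans (forall_congr' fun i => hf i A xs)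

theorem TupleDefinable.exists_fin {ι : Type*} [Finite ι]
    {Q : ι → (A : TeamModel.{u} X) → (Fin n → A.model.World) → Prop}
    (h : ∀ i, TupleDefinable n (Q i)) : TupleDefinable n fun A xs => ∃ i, Q i A xs := by
  choose f hf using h
  refine ⟨BoundedFormula.iSup f, fun A xs => ?_⟩
  let := A.foStructure
  exact BoundedFormula.realize_iSup.trans (exists_congr fun i => hf i A xs)

theorem TupleDefinable.forall
    {Q : (A : TeamModel.{u} X) → (Fin (n + 1) → A.model.World) → Prop}
    (h : TupleDefinable (n + 1) Q) :
    TupleDefinable n fun A xs => ∀ w, Q A (Fin.snoc xs w) := by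
  obtain ⟨φ, hφ⟩ := h
  exact ⟨φ.all, fun A xs => forall_congr' fun w => hφ A _⟩

theorem TupleDefinable.exists
    {Q : (A : TeamModel.{u} X) → (Fin (n + 1) → A.model.World) → Prop}
    (h : TupleDefinable (n + 1) Q) :
    TupleDefinable n fun A xs => ∃ w, Q A (Fin.snoc xs w) := by
  obtain ⟨φ, hφ⟩ := h
  refine ⟨φ.ex, fun A xs => ?_⟩
  let := A.foStructure
  exact BoundedFormula.realize_ex.trans (exists_congr fun w => hφ A _)

theorem TupleDefinable.team (i : Fin n) :
    TupleDefinable n fun (A : TeamModel.{u} X) xs => xs i ∈ A.team :=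
  ⟨_, fun A xs => realize_team A i xs⟩

theorem TupleDefinable.val (p : X) (i : Fin n) :
    TupleDefinable n fun (A : TeamModel.{u} X) xs => xs i ∈ A.model.val p :=
  ⟨_, fun A xs => realize_holds A p i xs⟩

theorem TupleDefinable.edge (i j : Fin n) :
    TupleDefinable n fun (A : TeamModel.{u} X) xs => A.model.R (xs i) (xs j) :=
  ⟨_, fun A xs => realize_edge A i j xs⟩

theorem TupleDefinable.mem_of_eq [Finite X] {k : ℕ} {i : Fin n}
    (h : ∀ σ, TupleDefinable n fun (A : TeamModel.{u} X) xs => A.model.bisimType k (xs i) = σ)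
    (S : Set (BisimType X k)) :
    TupleDefinable n fun (A : TeamModel.{u} X) xs => A.model.bisimType k (xs i) ∈ S := by
  simpa using TupleDefinable.exists_fin fun τ : S => h τ

theorem TupleDefinable.bisimType_eq [Finite X] (k : ℕ) (σ : BisimType X k) (i : Fin n) :
    TupleDefinable n fun (A : TeamModel.{u} X) xs => A.model.bisimType k (xs i) = σ := by
  -- A successor becomes the last of `n + 1` variables, so `n` must vary.
  induction k generalizing n with
  | zero =>
    simp only [KripkeModel.bisimType_zero_eq_iff]
    exact .forall_fin fun p => .iff (.val p i) (.const _)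
  | succ k ih =>
    simp only [KripkeModel.bisimType_succ_eq_iff]
    refine .and (.forall_fin fun p => .iff (.val p i) (.const _)) (.and ?_ (.forall_fin fun τ => ?_))
    · simpa using TupleDefinable.forall ((TupleDefinable.edge.{u} (X := X) i.castSucc
        (Fin.last n)).imp (.mem_of_eq (fun τ => ih τ (Fin.last n)) σ.2))
    · simpa using TupleDefinable.exists ((TupleDefinable.edge.{u} (X := X) i.castSucc
        (Fin.last n)).and (ih τ (Fin.last n)))

theorem KBisimInvariant.exists_sentence [Finite X] {k : ℕ} {P : TeamProperty.{u} X}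
    (hP : KBisimInvariant k P) : ∃ φ : (teamLanguage X).Sentence, FOExpresses φ P := by
  have key : TupleDefinable 0 fun (A : TeamModel.{u} X) _ =>
      ∃ S : TeamModel.bisimTypes k '' P, A.bisimTypes k = S := by
    refine .exists_fin fun S => ?_
    simp only [TeamModel.bisimTypes_eq_iff]
    refine .and ?_ (.forall_fin fun τ => ?_)
    · simpa [Fin.snoc] using TupleDefinable.forall ((TupleDefinable.team.{u} (X := X) (Fin.last 0)).imp
        (.mem_of_eq (fun τ => .bisimType_eq k τ (Fin.last 0)) S.1))
    · simpa [Fin.snoc] using TupleDefinable.exists ((TupleDefinable.team.{u} (X := X) (Fin.last 0)).and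
        (.bisimType_eq k τ.1 (Fin.last 0)))
  obtain ⟨φ, hφ⟩ := key
  exact ⟨φ, fun A => (hP.mem_iff A).trans (hφ A default).symm⟩

end FirstOrderDefinability

/-! ### Locality -/

section Locality

variable {X : Type v}

theorem KripkeModel.HasPath.tail {M : KripkeModel.{u} X} {n : ℕ} {w v x : M.World}
    (h : M.HasPath n w v) (hR : M.R v x) : M.HasPath (n + 1) w x := by
  induction n generalizing w with
  | zero =>
    obtain rfl : w = v := h
    exact ⟨x, hR, rfl⟩
  | succ n ih =>
    obtain ⟨y, hy, hp⟩ := h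
    exact ⟨y, hy, ih hp⟩

/-- A world reached in `n` steps has its next `j` steps inside the neighborhood as long as `n + j ≤
d`. -/
theorem TeamModel.kBisim_localize (A : TeamModel.{u} X) (d j n : ℕ) (hd : n + j ≤ d)
    (x : (A.localize d).model.World) (hx : ∃ w ∈ A.team, A.model.HasPath n w x.1) :
    KBisim A.model (A.localize d).model j x.1 x := by
  induction j generalizing n x with
  | zero => exact fun p => Iff.rfl
  | succ j ih =>
    obtain ⟨w, hw, hp⟩ := hx
    refine ⟨fun p => Iff.rfl, fun y hy => ?_, fun y hy => ?_⟩
    · have hp' := hp.tail hy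
      exact ⟨⟨y, w, hw, n + 1, by omega, hp'⟩, hy,
        ih (n + 1) (by omega) ⟨y, w, hw, n + 1, by omega, hp'⟩ ⟨w, hw, hp'⟩⟩
    · exact ⟨y.1, hy, ih (n + 1) (by omega) y ⟨w, hw, hp.tail hy⟩⟩

theorem TeamModel.teamKBisim_localize (A : TeamModel.{u} X) (d : ℕ) :
    TeamKBisim d A (A.localize d) := by
  refine ⟨fun w hw => ?_, fun x hx => ?_⟩
  · exact ⟨⟨w, A.model.subset_neighborhood A.team d hw⟩, hw,
      A.kBisim_localize d d 0 (by omega) ⟨w, A.model.subset_neighborhood A.team d hw⟩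
        ⟨w, hw, rfl⟩⟩
  · exact ⟨x.1, hx, A.kBisim_localize d d 0 (by omega) x ⟨x.1, hx, rfl⟩⟩

theorem KBisimInvariant.isLocal {k : ℕ} {P : TeamProperty.{u} X} (hP : KBisimInvariant k P) :
    IsLocal P :=
  ⟨k, fun A => ⟨hP _ _ (A.teamKBisim_localize k), hP _ _ (A.teamKBisim_localize k).symm⟩⟩

end Locality

/-! ### Layered models -/

section Layered

variable {X : Type v}

/-- Two copies of the unravelling of a model into layers, the second of which is cut off after
layer `d`. -/
def KripkeModel.layered (M : KripkeModel.{u} X) (d : ℕ) : KripkeModel.{u} X where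
  World := {x : Bool × M.World × ℕ // x.1 = true → x.2.2 ≤ d}
  nonempty := by
    obtain ⟨w⟩ := M.nonempty
    exact ⟨⟨(false, w, 0), by simp⟩⟩
  R x y := x.1.1 = y.1.1 ∧ M.R x.1.2.1 y.1.2.1 ∧ y.1.2.2 = x.1.2.2 + 1
  val p := {x | x.1.2.1 ∈ M.val p}

/-- The layered model with the team placed in the bottom layer of the full copy (`b = false`) or
of the cut-off copy (`b = true`). -/
def TeamModel.layered (A : TeamModel.{u} X) (d : ℕ) (b : Bool) : TeamModel.{u} X where
  model := A.model.layered d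
  team := {x | x.1.1 = b ∧ x.1.2.1 ∈ A.team ∧ x.1.2.2 = 0}
  team_nonempty := by
    obtain ⟨w, hw⟩ := A.team_nonempty
    exact ⟨⟨(b, w, 0), by simp⟩, rfl, hw, rfl⟩

theorem TeamModel.teamBisim_layered (A : TeamModel.{u} X) (d : ℕ) :
    TeamBisim A (A.layered d false) := by
  refine ⟨fun w x => x.1.1 = false ∧ x.1.2.1 = w, ?_, ?_, ?_⟩
  · rintro _ ⟨⟨b, w, l⟩, hx⟩ ⟨hb, rfl⟩
    obtain rfl : b = false := hb
    refine ⟨fun p => Iff.rfl, fun v hv => ?_, ?_⟩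
    · exact ⟨⟨(false, v, l + 1), by simp⟩, ⟨rfl, hv, rfl⟩, rfl, rfl⟩
    · rintro ⟨⟨b, v, l'⟩, hy⟩ ⟨hb, hR, -⟩
      exact ⟨v, hR, hb.symm, rfl⟩
  · exact fun w hw => ⟨⟨(false, w, 0), by simp⟩, ⟨rfl, hw, rfl⟩, rfl, rfl⟩
  · rintro x ⟨hb, hw, -⟩
    exact ⟨x.1.2.1, hw, hb, rfl⟩

/-- In the cut copy a world of layer `l` has at most `d - l` steps ahead, so `(d - l)`-bisimilarity
there already yields a full bisimulation. -/
theorem TeamKBisim.layered {d : ℕ} {A B : TeamModel.{u} X} (h : TeamKBisim d A B) :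
    TeamBisim (A.layered d true) (B.layered d true) := by
  refine ⟨fun x y => x.1.1 = true ∧ y.1.1 = true ∧ x.1.2.2 = y.1.2.2 ∧
    KBisim A.model B.model (d - x.1.2.2) x.1.2.1 y.1.2.1, ?_, ?_, ?_⟩
  · rintro ⟨⟨b, w, l⟩, hx⟩ ⟨⟨b', w', l'⟩, hx'⟩ ⟨hb, hb', hl, hk⟩
    obtain rfl : b = true := hb
    obtain rfl : b' = true := hb'
    obtain rfl : l = l' := hl
    refine ⟨hk.sameVars, ?_, ?_⟩
    · rintro ⟨⟨b, v, m⟩, hy⟩ ⟨hb, hR, hm⟩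
      obtain rfl : true = b := hb
      obtain rfl : m = l + 1 := hm
      -- The successor survives the cut, so `d - l` is positive and the bisimilarity has a step left
      -- to spend.
      have hd : l + 1 ≤ d := hy rfl
      obtain ⟨e, rfl⟩ := Nat.exists_eq_add_of_le hd
      have he : l + 1 + e - l = e + 1 := by omega
      have he' : l + 1 + e - (l + 1) = e := by omega
      simp only [he] at hk
      obtain ⟨v', hv', hk'⟩ := hk.2.1 v hR
      exact ⟨⟨(true, v', l + 1), hy⟩, ⟨rfl, hv', rfl⟩, rfl, rfl, rfl, by simpa only [he'] using hk'⟩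
    · rintro ⟨⟨b, v, m⟩, hy⟩ ⟨hb, hR, hm⟩
      obtain rfl : true = b := hb
      obtain rfl : m = l + 1 := hm
      have hd : l + 1 ≤ d := hy rfl
      obtain ⟨e, rfl⟩ := Nat.exists_eq_add_of_le hd
      have he : l + 1 + e - l = e + 1 := by omega
      have he' : l + 1 + e - (l + 1) = e := by omega
      simp only [he] at hk
      obtain ⟨v', hv', hk'⟩ := hk.2.2 v hR
      exact ⟨⟨(true, v', l + 1), hy⟩, ⟨rfl, hv', rfl⟩, rfl, rfl, rfl, by simpa only [he'] using hk'⟩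
  · rintro ⟨⟨b, w, l⟩, hx⟩ ⟨hb, hw, hl⟩
    obtain rfl : l = 0 := hl
    obtain ⟨w', hw', hk⟩ := h.1 w hw
    exact ⟨⟨(true, w', 0), by simp⟩, ⟨rfl, hw', rfl⟩, hb, rfl, rfl, hk⟩
  · rintro ⟨⟨b, w, l⟩, hx⟩ ⟨hb, hw, hl⟩
    obtain rfl : l = 0 := hl
    obtain ⟨w', hw', hk⟩ := h.2 w hw
    exact ⟨⟨(true, w', 0), by simp⟩, ⟨rfl, hw', rfl⟩, rfl, hb, rfl, hk⟩

theorem KripkeModel.HasPath.level_eq {M : KripkeModel.{u} X} {d n : ℕ}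
    {x y : (M.layered d).World} (h : (M.layered d).HasPath n x y) :
    y.1.2.2 = x.1.2.2 + n := by
  induction n generalizing x with
  | zero =>
    obtain rfl : x = y := h
    rfl
  | succ n ih =>
    obtain ⟨z, hz, hp⟩ := h
    have h1 := ih hp
    have h2 := hz.2.2
    omega

/-- Every edge climbs one layer and the team lies in layer 0, so distance from the team equals the
layer and both cuts fall at the same place. -/
theorem TeamModel.teamBisim_localize_layered (A : TeamModel.{u} X) (d : ℕ) :
    TeamBisim ((A.layered d false).localize d) (A.layered d true) := by
  refine ⟨fun x y => x.1.1.1 = false ∧ y.1.1 = true ∧ x.1.1.2 = y.1.2, ?_, ?_, ?_⟩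
  · rintro ⟨⟨⟨b, w, l⟩, hx⟩, t, ht, n, hn, hp⟩ ⟨⟨b', w', l'⟩, hx'⟩ ⟨hb, hb', h⟩
    obtain rfl : b = false := hb
    obtain rfl : b' = true := hb'
    obtain ⟨rfl, rfl⟩ := Prod.mk.inj h
    have hl := KripkeModel.HasPath.level_eq hp
    have ht0 : t.1.2.2 = 0 := ht.2.2
    have hln : l = n := by simpa [ht0] using hl
    refine ⟨fun p => Iff.rfl, ?_, ?_⟩
    · rintro ⟨⟨⟨b, v, m⟩, hy⟩, t', ht', n', hn', hp'⟩ ⟨hb, hR, hm⟩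
      obtain rfl : m = l + 1 := hm
      have hl' := KripkeModel.HasPath.level_eq hp'
      have ht0' : t'.1.2.2 = 0 := ht'.2.2
      have hln' : l + 1 = n' := by simpa [ht0'] using hl'
      exact ⟨⟨(true, v, l + 1), fun _ => show l + 1 ≤ d by omega⟩, ⟨rfl, hR, rfl⟩, hb.symm, rfl, rfl⟩
    · rintro ⟨⟨b, v, m⟩, hy⟩ ⟨hb, hR, hm⟩
      obtain rfl : true = b := hb
      obtain rfl : m = l + 1 := hm
      have hd : l + 1 ≤ d := hy rfl
      exact ⟨⟨⟨(false, v, l + 1), by simp⟩, t, ht, n + 1, by omega, hp.tail ⟨rfl, hR, rfl⟩⟩,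
        ⟨rfl, hR, rfl⟩, rfl, rfl, rfl⟩
  · rintro ⟨⟨⟨b, w, l⟩, hx⟩, hmem⟩ ⟨hb, hw, hl⟩
    obtain rfl : l = 0 := hl
    exact ⟨⟨(true, w, 0), by simp⟩, ⟨rfl, hw, rfl⟩, hb, rfl, rfl⟩
  · rintro ⟨⟨b, w, l⟩, hx⟩ ⟨hb, hw, hl⟩
    obtain rfl : l = 0 := hl
    have hmem : (⟨(false, w, 0), by simp⟩ : (A.layered d false).model.World) ∈
        (A.layered d false).team := ⟨rfl, hw, rfl⟩
    exact ⟨⟨_, KripkeModel.subset_neighborhood _ _ d hmem⟩, hmem, rfl, hb, rfl⟩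

/-- A bisimulation-invariant property is `d`-bisimulation-invariant as soon as it does not
distinguish the two placements of the team in layered models of depth `d`. -/
theorem BisimInvariant.kBisimInvariant {P : TeamProperty.{u} X} (hP : BisimInvariant P) {d : ℕ}
    (h : ∀ A : TeamModel.{u} X, A.layered d false ∈ P ↔ A.layered d true ∈ P) :
    KBisimInvariant d P := by
  intro A B hAB hA
  -- The chain runs from `B` to its full copy, its cut copy, the cut copy of `A`, the full copy of
  -- `A`, and `A`.
  rw [hP.mem_iff (B.teamBisim_layered d), h, ← hP.mem_iff hAB.layered, ← h,
    ← hP.mem_iff (A.teamBisim_layered d)]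
  exact hA

theorem BisimInvariant.kBisimInvariant_of_isDLocal {P : TeamProperty.{u} X}
    (hP : BisimInvariant P) {d : ℕ} (hd : IsDLocal d P) : KBisimInvariant d P :=
  hP.kBisimInvariant fun A => (hd _).trans (hP.mem_iff (A.teamBisim_localize_layered d))

/-! ### First-order sentences cannot see a deep cut -/

/-- The layer of a world of a layered model. -/
def KripkeModel.level {M : KripkeModel.{u} X} {d : ℕ} (x : (M.layered d).World) : ℕ :=
  x.1.2.2

/-- Exchange the two copies in the layers up to `c`, and do nothing above. -/
def KripkeModel.swap {M : KripkeModel.{u} X} {d c : ℕ} (hc : c ≤ d) (x : (M.layered d).World) :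
    (M.layered d).World :=
  ⟨(if x.1.2.2 ≤ c then !x.1.1 else x.1.1, x.1.2), fun h => by
    by_cases hx : x.1.2.2 ≤ c
    · exact hx.trans hc
    · exact x.2 (by simpa [hx] using h)⟩

section Swap

open KripkeModel

variable {M : KripkeModel.{u} X} {d c : ℕ} (hc : c ≤ d)

theorem KripkeModel.swap_swap (x : (M.layered d).World) : swap hc (swap hc x) = x := by
  apply Subtype.ext
  by_cases hx : x.1.2.2 ≤ c <;> simp [swap, hx]

theorem KripkeModel.level_swap (x : (M.layered d).World) : level (swap hc x) = level x :=
  rfl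

theorem KripkeModel.swap_inj {x y : (M.layered d).World} : swap hc x = swap hc y ↔ x = y :=
  (Function.Involutive.injective (swap_swap hc)).eq_iff

theorem KripkeModel.swap_congr {c' : ℕ} (hc' : c' ≤ d) {x : (M.layered d).World}
    (h : level x ≤ c ↔ level x ≤ c') : swap hc x = swap hc' x := by
  apply Subtype.ext
  simp only [level] at h
  simp [swap, h]

/-- Both ends of an edge lie on the same side of the boundary above layer `c`, unless the edge
starts in layer `c`. -/
theorem KripkeModel.layered_R_swap {x y : (M.layered d).World}
    (hx : level x < c ∨ c < level x) :
    (M.layered d).R (swap hc x) (swap hc y) ↔ (M.layered d).R x y := by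
  have key : y.1.2.2 = x.1.2.2 + 1 → (y.1.2.2 ≤ c ↔ x.1.2.2 ≤ c) := by
    simp only [level] at hx
    omega
  simp only [KripkeModel.layered, swap]
  constructor
  · rintro ⟨h1, h2, h3⟩
    refine ⟨?_, h2, h3⟩
    by_cases h : x.1.2.2 ≤ c <;> simpa [key h3, h] using h1
  · rintro ⟨h1, h2, h3⟩
    refine ⟨?_, h2, h3⟩
    by_cases h : x.1.2.2 ≤ c <;> simpa [key h3, h] using h1

theorem TeamModel.swap_mem_team {A : TeamModel.{u} X} (x : (A.model.layered d).World) :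
    swap hc x ∈ (A.layered d true).team ↔ x ∈ (A.layered d false).team := by
  constructor
  · rintro ⟨h1, h2, h3⟩
    have h3' : x.1.2.2 = 0 := h3
    exact ⟨by simpa [swap, h3'] using h1, h2, h3⟩
  · rintro ⟨h1, h2, h3⟩
    exact ⟨by simp [swap, h3, h1], h2, h3⟩

end Swap

open KripkeModel in
/-- Exchanging the two copies below a layer which is far from the bottom, from the cut, and from
all parameters of a first-order formula does not affect the truth of that formula. -/
theorem exists_realize_swap_iff {n : ℕ} (φ : (teamLanguage X).BoundedFormula Empty n) :
    ∃ N ≥ 1, ∀ (A : TeamModel.{u} X) (d c : ℕ) (hc : c ≤ d), c + N ≤ d → N ≤ c →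
      ∀ xs : Fin n → (A.model.layered d).World,
        (∀ i, level (xs i) + N ≤ c ∨ c + N < level (xs i)) →
        ((A.layered d false).Realize φ xs ↔
          (A.layered d true).Realize φ fun i => swap hc (xs i)) := by
  -- There are no function symbols and no free variables, so every term is one of the `m` indexed
  -- variables.
  have hterm : ∀ {m : ℕ} (t : (teamLanguage X).Term (Empty ⊕ Fin m)), ∃ i, t = .var (.inr i) := by
    rintro m ((e | i) | ⟨f, -⟩)
    · exact e.elim
    · exact ⟨i, rfl⟩
    · exact Empty.elim f
  induction φ with
  | falsum => exact ⟨1, le_rfl, fun _ _ _ _ _ _ _ _ => Iff.rfl⟩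
  | equal t₁ t₂ =>
    obtain ⟨i, rfl⟩ := hterm t₁
    obtain ⟨j, rfl⟩ := hterm t₂
    exact ⟨1, le_rfl, fun A d c hc _ _ xs _ => (swap_inj hc).symm⟩
  | rel r ts =>
    choose f hf using fun i => hterm (ts i)
    obtain rfl : ts = fun i => .var (.inr (f i)) := funext hf
    refine ⟨1, le_rfl, fun A d c hc _ _ xs hxs => ?_⟩
    cases r with
    | edge =>
      refine (layered_R_swap hc ?_).symm
      have := hxs (f 0)
      change level (xs (f 0)) < c ∨ c < level (xs (f 0))
      omega
    | team => exact (A.swap_mem_team hc (xs (f 0))).symm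
    | holds p => exact Iff.rfl
  | imp φ ψ ih₁ ih₂ =>
    obtain ⟨N, hN, h⟩ := ih₁
    obtain ⟨N', hN', h'⟩ := ih₂
    refine ⟨max N N', by omega, fun A d c hc hd hc' xs hxs => imp_congr
      (h A d c hc (by omega) (by omega) xs fun i => ?_)
      (h' A d c hc (by omega) (by omega) xs fun i => ?_)⟩
    · have := hxs i
      omega
    · have := hxs i
      omega
  | all φ ih =>
    obtain ⟨N, hN, h⟩ := ih
    -- The margin doubles with each quantifier: half of it pays for moving the boundary away from
    -- the new element.
    refine ⟨2 * N, by omega, fun A d c hc hd hc' xs hxs => ?_⟩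
    -- The new boundary `c'` depends only on the layer of the new element, which the swap preserves,
    -- so one choice serves both directions.
    have key : ∀ l : ℕ, ∃ (c' : ℕ) (hc' : c' ≤ d), ∀ x : (A.model.layered d).World, level x = l →
        ((A.layered d false).Realize φ (Fin.snoc xs x) ↔
          (A.layered d true).Realize φ (Fin.snoc (fun i => swap hc (xs i)) (swap hc' x))) := by
      intro l
      obtain ⟨c', hd', hc', hl, hx⟩ : ∃ c', c' + N ≤ d ∧ N ≤ c' ∧ (l + N ≤ c' ∨ c' + N < l) ∧
          ∀ i, (level (xs i) + N ≤ c' ∨ c' + N < level (xs i)) ∧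
            (level (xs i) ≤ c ↔ level (xs i) ≤ c') := by
        by_cases hl : l ≤ c
        · refine ⟨c + N, by omega, by omega, by omega, fun i => ?_⟩
          have := hxs i
          omega
        · refine ⟨c - N, by omega, by omega, by omega, fun i => ?_⟩
          have := hxs i
          omega
      refine ⟨c', by omega, fun x hxl => (h A d c' (by omega) hd' hc' (Fin.snoc xs x) ?_).trans
        (iff_of_eq (congrArg _ ?_))⟩
      · refine Fin.lastCases ?_ fun i => ?_
        · simpa [hxl] using hl
        · simpa using (hx i).1
      · funext i
        refine Fin.lastCases ?_ (fun i => ?_) i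
        · rw [Fin.snoc_last]
          exact (Fin.snoc_last (α := fun _ => (A.model.layered d).World) _ _).symm
        · rw [Fin.snoc_castSucc]
          exact (swap_congr hc (by omega) (hx i).2).symm.trans
            (Fin.snoc_castSucc (α := fun _ => (A.model.layered d).World) _
              (fun i => swap hc (xs i)) i).symm
    constructor
    · intro hall y
      obtain ⟨c', hc', hiff⟩ := key (level y)
      have := (hiff (swap hc' y) (level_swap hc' y)).1 (hall _)
      rwa [show swap hc' (swap hc' y) = y from swap_swap hc' y] at this
    · intro hall x
      obtain ⟨c', hc', hiff⟩ := key (level x)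
      exact (hiff x rfl).2 (hall _)

theorem FOExpresses.exists_layered_iff {P : TeamProperty.{u} X} {φ : (teamLanguage X).Sentence}
    (hφ : FOExpresses φ P) :
    ∃ d, ∀ A : TeamModel.{u} X, A.layered d false ∈ P ↔ A.layered d true ∈ P := by
  obtain ⟨N, -, h⟩ := exists_realize_swap_iff.{u} φ
  -- With no parameters, `c = N` and `d = 2N` leave exactly the margin `N` on both sides.
  refine ⟨N + N, fun A => (hφ _).trans (Iff.trans ?_ (hφ _).symm)⟩
  refine (h A (N + N) N (by omega) le_rfl le_rfl default fun i => i.elim0).trans ?_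
  exact iff_of_eq (congrArg _ (funext fun i => i.elim0))

end Layered

/-! ### The equivalence of the four conditions -/

theorem theorem1 {X : Type v} [Finite X] [Nonempty X] (P : TeamProperty.{u} X) :
    List.TFAE [
      ∃ φ : MTL X, φ.Expresses P,
      (∃ φ : (teamLanguage X).Sentence, FOExpresses φ P) ∧ BisimInvariant P,
      ∃ k : ℕ, KBisimInvariant k P,
      BisimInvariant P ∧ IsLocal P] := by
  tfae_have 1 → 3 := by
    rintro ⟨φ, hφ⟩
    obtain ⟨k, hk⟩ := φ.exists_kBisim_invariant
    exact ⟨k, fun A B h hA => (hφ B).2 (hk _ _ _ _ h ((hφ A).1 hA))⟩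
  tfae_have 3 → 1 := fun ⟨_, hk⟩ => hk.exists_mtl
  tfae_have 3 → 2 := fun ⟨_, hk⟩ => ⟨hk.exists_sentence, hk.bisimInvariant⟩
  tfae_have 3 → 4 := fun ⟨_, hk⟩ => ⟨hk.bisimInvariant, hk.isLocal⟩
  tfae_have 4 → 3 := fun ⟨hP, d, hd⟩ => ⟨d, hP.kBisimInvariant_of_isDLocal hd⟩
  tfae_have 2 → 3 := by
    rintro ⟨⟨φ, hφ⟩, hP⟩
    obtain ⟨d, hd⟩ := hφ.exists_layered_iff
    exact ⟨d, hP.kBisimInvariant hd⟩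
  tfae_finish
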